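/- Conventions. For a ring $A$, complexes of (left) $A$-modules are graded homologically. A complex $P$ is \emph{semi-projective} if $\mathrm{Hom}_A(P,\beta)$ is a surjective quasi-isomorphism for every surjective quasi-isomorphism $\beta$ of complexes of $A$-modules. Put $\sup P=\sup\{i\in\mathbb Z: P_i\neq 0\}$ and $\mathrm{hsup}\,P=\sup\{i\in\mathbb Z:\mathrm H_i(P)\neq 0\}$; $P$ is \emph{bounded above} if $P_i=0$ for all $i\gg 0$. A \emph{quasi-projective resolution} of a complex $M$ of $A$-modules is a semi-projective complex $P$ for which there are an integer $\ell$ and integers $a_i\ge 0$ ($i\ge \ell$), not all zero, with $$\mathrm H(P)\cong\bigoplus_{i\ge \ell}\mathrm H(\Sigma^iM^{a_i})$$ as graded $A$-modules. The \emph{quasi-projective dimension} of $M$ is $$\mathrm{qpd}_AM=\inf\{\sup P-\mathrm{hsup}\,P : P\text{ is a bounded above quasi-projective resolution of }M\}$$ if $M$ is not exact (so $\mathrm{qpd}_AM=\infty$ if there is no such $P$), and $\mathrm{qpd}_AM=-\infty$ if $M$ is exact. A module is regarded as a complex concentrated in degree $0$. Corollary. Let $R$ be a commutative noetherian local ring,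 let $\mathbf x=x_1,\dots,x_d$ be an $R$-regular sequence, and let $M$ be a nonzero finitely generated $R/(\mathbf x)$-module, regarded also as an $R$-module through $R\to R/(\mathbf x)$. If $\mathrm{Ext}^1_R(M,M)=0$, then $\mathrm{qpd}_RM<\infty$ if and only if $\mathrm{qpd}_{R/(\mathbf x)}M<\infty$. -/

import Mathlib

open CategoryTheory

universe u

namespace QuasiProj

open scoped DirectSum

/-- Complexes of left `R`-modules.  They are indexed cohomologically; the component in
homological degree `i` is the one in cohomological degree `-i`. -/
abbrev Cpx (R : Type u) [Ring R] := CochainComplex (ModuleCat.{u} R) ℤ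

section

variable {R : Type u} [Ring R]

/-- The component `M_i` in homological degree `i`. -/
abbrev comp (M : Cpx R) (i : ℤ) : ModuleCat.{u} R := M.X (-i)

/-- The homology `H_i(M)` in homological degree `i`. -/
noncomputable abbrev hom (M : Cpx R) (i : ℤ) : ModuleCat.{u} R := M.homology (-i)

/-- `sup M = sup {i ∈ ℤ | M_i ≠ 0}`. -/
noncomputable def sup (M : Cpx R) : EReal :=
  sSup {q : EReal | ∃ i : ℤ, Nontrivial (comp M i) ∧ q = ((i : ℝ) : EReal)}

/-- `hsup M = sup {i ∈ ℤ | H_i(M) ≠ 0}`. -/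
noncomputable def hsup (M : Cpx R) : EReal :=
  sSup {q : EReal | ∃ i : ℤ, Nontrivial (hom M i) ∧ q = ((i : ℝ) : EReal)}

/-- `M_i = 0` for all large homological degrees `i`. -/
def IsBoundedAbove (M : Cpx R) : Prop :=
  ∃ n : ℤ, ∀ i : ℤ, n < i → Subsingleton (comp M i)

/-- The chain map `Hom_R(P, β) : Hom_R(P, X) → Hom_R(P, Y)` between total Hom complexes
induced by a chain map `β : X → Y`. -/
noncomputable def homMap (P : Cpx R) {X Y : Cpx R} (β : X ⟶ Y) :
    CochainComplex.HomComplex P X ⟶ CochainComplex.HomComplex P Y where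
  f n := AddCommGrpCat.ofHom
    { toFun := fun z : CochainComplex.HomComplex.Cochain P X n =>
        z.comp (CochainComplex.HomComplex.Cochain.ofHom β) (add_zero n)
      map_zero' := by simp
      map_add' := by intro a b; simp }
  comm' i j _ := by
    ext z
    exact CochainComplex.HomComplex.δ_comp_ofHom (show
      CochainComplex.HomComplex.Cochain P X i from z) β j

/-- `P` is semi-projective: `Hom_R(P, β)` is a surjective quasi-isomorphism for every
surjective quasi-isomorphism `β`. -/
def IsSemiProjective (P : Cpx R) : Prop :=
  ∀ ⦃X Y : Cpx R⦄ (β : X ⟶ Y), (∀ n : ℤ, Function.Surjective (β.f n)) → QuasiIso β →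
    (∀ n : ℤ, Function.Surjective ((homMap P β).f n)) ∧ QuasiIso (homMap P β)

/-- `P` is a quasi-projective resolution of `M`: it is semi-projective and there are `ℓ ∈ ℤ`
and natural numbers `a_i` (`i ≥ ℓ`), not all zero, such that `H(P)` is isomorphic, as a graded
module, to `⨁_{i ≥ ℓ} H(Σ^i M^{a_i})`; in degree `n` the latter is
`⨁_{i ≥ ℓ} H_{n-i}(M)^{a_i}`. -/
def IsQuasiProjRes (M P : Cpx R) : Prop :=
  IsSemiProjective P ∧
    ∃ (l : ℤ) (a : {i : ℤ // l ≤ i} → ℕ), (∃ i, a i ≠ 0) ∧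
      ∀ n : ℤ, Nonempty
        (hom P n ≃ₗ[R] ⨁ i : {i : ℤ // l ≤ i}, (Fin (a i) → hom M (n - i.1)))

open Classical in
/-- The quasi-projective dimension of a complex: `-∞` for an exact complex, and otherwise the
infimum of `sup P - hsup P` over the bounded above quasi-projective resolutions `P`. -/
noncomputable def qpdCpx (M : Cpx R) : EReal :=
  if M.Acyclic then ⊥
  else sInf {q : EReal | ∃ P : Cpx R, IsQuasiProjRes M P ∧ IsBoundedAbove P ∧
    q = sup P - hsup P}

end

/-- The quasi-projective dimension of a module, regarded as a complex concentrated in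
degree `0`. -/
noncomputable def qpd (R : Type u) [Ring R] (M : Type u) [AddCommGroup M] [Module R M] : EReal :=
  qpdCpx ((HomologicalComplex.single (ModuleCat.{u} R) (ComplexShape.up ℤ) 0).obj
    (ModuleCat.of R M))

end QuasiProj

/-! For `M ≠ 0`, finiteness of qpd means that some bounded above semi-projective `P` has `H_n(P) ≅
M^{a_n}`, with the `a_n` not all zero and vanishing for `n ≪ 0`. By induction on the sequence it is
enough to pass between `R` and `S = R/(x)` with `x` regular.

From `R` to `S` (`HasQuasiProjRes.of_surjective`): `S ⊗ P = P/xP` is semi-projective over `S`. Since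
`x` kills `M`, multiplication by `x` is zero on `H(P)`, and `0 → P → P → P/xP → 0` gives extensions
`0 → H_n(P) → H_n(P/xP) → H_{n-1}(P) → 0`. They split because `Ext¹_R(M, M) = 0`, so `H_n(P/xP) ≅
M^{a_n + a_{n-1}}`.

From `S` to `R` (`HasQuasiProjRes.restrictScalars`): the homology of `P` vanishes in low degrees, so
`P` can be truncated to a bounded complex of projectives. Over `R` these have projective dimension
at most one, and `exists_resolution` replaces the complex by a quasi-isomorphic bounded complex of
projective `R`-modules. -/

namespace QuasiProj
open scoped DirectSum
open CochainComplex HomologicalComplex Limits ZeroObject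

/-! ### Semi-projective means K-projective with projective terms -/

section
variable {R : Type u} [Ring R]

lemma acyclic_homComplex (P : Cpx R) [P.IsKProjective] {A : Cpx R} (hA : A.Acyclic) :
    (HomComplex P A).Acyclic := by
  intro n
  rw [exactAt_iff_isZero_homology]
  have key : Subsingleton (HomComplex.CohomologyClass P A n) := by
    have h : (A⟦n⟧).Acyclic := by
      have := (HomotopyCategory.quotient_obj_mem_subcategoryAcyclic_iff_acyclic A).2 hA
      rw [← HomotopyCategory.quotient_obj_mem_subcategoryAcyclic_iff_acyclic]
      exact ObjectProperty.prop_of_iso _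
        (((HomotopyCategory.quotient _ (.up ℤ)).commShiftIso n).symm.app A)
        ((HomotopyCategory.subcategoryAcyclic _).le_shift n _ this)
    have h' := (HomotopyCategory.quotient_obj_mem_subcategoryAcyclic_iff_acyclic _).2 h
    refine ⟨fun a b => (HomComplex.CohomologyClass.toHom_bijective P A n).injective ?_⟩
    exact (IsKProjective.leftOrthogonal P _ h').trans (IsKProjective.leftOrthogonal P _ h').symm
  have : Subsingleton ((HomComplex P A).homology n) :=
    (HomComplex.homologyAddEquiv P A n).injective.subsingleton
  exact AddCommGrpCat.isZero_of_subsingleton _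

lemma quasiIso_g_of_acyclic_X₁ {C : Type*} [Category* C] [Abelian C] {ι : Type*}
    {c : ComplexShape ι} {S : ShortComplex (HomologicalComplex C c)} (hS : S.ShortExact)
    (h : S.X₁.Acyclic) : QuasiIso S.g := by
  have hz (i : ι) : IsZero (S.X₁.homology i) := (h i).isZero_homology
  rw [quasiIso_iff]
  intro i
  rw [quasiIsoAt_iff_isIso_homologyMap]
  have hm : Mono (homologyMap S.g i) :=
    (hS.homology_exact₂ i).mono_g ((hz i).eq_of_src _ _)
  have he : Epi (homologyMap S.g i) := by
    by_cases hi : ∃ j, c.Rel i j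
    · obtain ⟨j, hij⟩ := hi
      exact (hS.homology_exact₃ i j hij).epi_f ((hz j).eq_of_tgt _ _)
    · have := hS.epi_g
      exact epi_homologyMap_of_epi_of_not_rel S.g i (by simpa using hi)
  exact isIso_of_mono_of_epi _

lemma shortExact_kernel {X Y : Cpx R} (β : X ⟶ Y)
    (hβ : ∀ n : ℤ, Function.Surjective (β.f n)) :
    (ShortComplex.mk (kernel.ι β) β (kernel.condition β)).ShortExact where
  exact := ShortComplex.exact_kernel β
  mono_f := inferInstanceAs (Mono (kernel.ι β))
  epi_g := by
    have (n : ℤ) : Epi (β.f n) := (ModuleCat.epi_iff_surjective _).2 (hβ n)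
    exact epi_of_epi_f β (fun n => this n)

lemma homMap_surjective (P : Cpx R) [∀ n, Projective (P.X n)] {X Y : Cpx R} (β : X ⟶ Y)
    (hβ : ∀ n : ℤ, Function.Surjective (β.f n)) (n : ℤ) :
    Function.Surjective ((homMap P β).f n) := by
  have (n : ℤ) : Epi (β.f n) := (ModuleCat.epi_iff_surjective _).2 (hβ n)
  intro (z : HomComplex.Cochain P Y n)
  refine ⟨HomComplex.Cochain.mk fun p q hpq => Projective.factorThru (z.v p q hpq) (β.f q), ?_⟩
  change HomComplex.Cochain.comp _ _ (add_zero n) = z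
  ext p q hpq
  simp

lemma isSemiProjective_of_isKProjective (P : Cpx R) [∀ n, Projective (P.X n)]
    [P.IsKProjective] : IsSemiProjective P := by
  intro X Y β hβ hq
  refine ⟨homMap_surjective P β hβ, ?_⟩
  have hS := shortExact_kernel β hβ
  have hA : (kernel β).Acyclic := hS.acyclic_X₁ hq
  have hw : homMap P (kernel.ι β) ≫ homMap P β = 0 := by
    ext n (z : HomComplex.Cochain P _ n)
    change HomComplex.Cochain.comp (HomComplex.Cochain.comp z _ (add_zero n)) _ (add_zero n) = 0
    ext p q hpq
    simp [← HomologicalComplex.comp_f]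
  refine quasiIso_g_of_acyclic_X₁ (S := ShortComplex.mk _ _ hw) ?_ (acyclic_homComplex P hA)
  refine shortExact_of_degreewise_shortExact _ fun n => ?_
  have hSd (q : ℤ) := hS.map_of_exact (HomologicalComplex.eval _ _ q)
  refine @ShortComplex.ShortExact.mk _ _ _ _ ((ShortComplex.ab_exact_iff _).2 ?_)
    ((AddCommGrpCat.mono_iff_injective _).2 ?_) ((AddCommGrpCat.epi_iff_surjective _).2
    (homMap_surjective P β hβ n))
  · intro (z : HomComplex.Cochain P X n) hz
    have hz' (p q : ℤ) (hpq : p + n = q) : z.v p q hpq ≫ β.f q = 0 := by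
      have := HomComplex.Cochain.congr_v
        (show z.comp (HomComplex.Cochain.ofHom β) (add_zero n) = 0 from hz) p q hpq
      simpa using this
    have hl (p q : ℤ) (hpq : p + n = q) :
        ∃ w : P.X p ⟶ (kernel β).X q, w ≫ (kernel.ι β).f q = z.v p q hpq := by
      have := (hSd q).mono_f
      exact ⟨(hSd q).exact.lift (z.v p q hpq) (hz' p q hpq), (hSd q).exact.lift_f _ _⟩
    choose w hw using hl
    refine ⟨HomComplex.Cochain.mk w, ?_⟩
    change HomComplex.Cochain.comp _ _ (add_zero n) = z
    refine HomComplex.Cochain.ext _ _ fun p q hpq => ?_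
    simpa using hw p q hpq
  · refine (injective_iff_map_eq_zero ((homMap P (kernel.ι β)).f n).hom).2 ?_
    intro (z : HomComplex.Cochain P _ n) hz
    refine HomComplex.Cochain.ext _ _ fun p q hpq => ?_
    have hz : z.comp (HomComplex.Cochain.ofHom (kernel.ι β)) (add_zero n) = 0 := hz
    have := HomComplex.Cochain.congr_v hz p q hpq
    have h2 : Mono ((kernel.ι β).f q) := (hSd q).mono_f
    refine (cancel_mono ((kernel.ι β).f q)).1
      (Eq.trans ?_ (zero_comp (X := P.X p) (f := (kernel.ι β).f q)).symm)
    simpa using this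

/-- The defining property is tested on `A ⟶ 0` with `A` acyclic: it makes `Hom(P, A)` acyclic in
degree `0`, so every chain map `P ⟶ A` is a coboundary, that is, null-homotopic. -/
lemma IsSemiProjective.isKProjective {P : Cpx R} (hP : IsSemiProjective P) :
    P.IsKProjective where
  nonempty_homotopy_zero {A} f hA := by
    have h0 : (0 : Cpx R).Acyclic := fun i => by
      rw [exactAt_iff_isZero_homology]
      exact (homologyFunctor _ _ i).map_isZero (isZero_zero _)
    have hq : QuasiIso (0 : A ⟶ 0) := by
      rw [quasiIso_iff]
      intro i
      rw [quasiIsoAt_iff_exactAt _ _ (hA i)]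
      exact h0 i
    have hs : ∀ n : ℤ, Function.Surjective ((0 : A ⟶ 0).f n) := fun n x =>
      ⟨0, by
        have : Subsingleton ((0 : Cpx R).X n) := ModuleCat.subsingleton_of_isZero
          ((HomologicalComplex.eval _ _ n).map_isZero (isZero_zero _))
        exact Subsingleton.elim _ _⟩
    have := (hP (0 : A ⟶ 0) hs hq).2
    have hH : IsZero ((HomComplex P (0 : Cpx R)).homology 0) := by
      rw [← exactAt_iff_isZero_homology]
      apply ShortComplex.exact_of_isZero_X₂
      refine @AddCommGrpCat.isZero_of_subsingleton _ ⟨fun a b => ?_⟩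
      apply HomComplex.Cochain.ext
      intro p q hpq
      exact IsZero.eq_of_tgt ((HomologicalComplex.eval _ _ q).map_isZero (isZero_zero _)) _ _
    have hz : IsZero ((HomComplex P A).homology 0) :=
      hH.of_iso (asIso (homologyMap (homMap P (0 : A ⟶ 0)) 0))
    have hsub : Subsingleton ((HomComplex P A).homology 0) :=
      AddCommGrpCat.subsingleton_of_isZero hz
    have hc : Subsingleton (HomComplex.CohomologyClass P A 0) :=
      (HomComplex.homologyAddEquiv P A 0).symm.injective.subsingleton
    have hf := (HomComplex.CohomologyClass.mk_eq_zero_iff _).1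
      (Subsingleton.elim (HomComplex.CohomologyClass.mk (HomComplex.Cocycle.ofHom f)) 0)
    rw [HomComplex.mem_coboundaries_iff _ (-1) (by simp)] at hf
    obtain ⟨z, hz⟩ := hf
    exact ⟨(HomComplex.Cochain.equivHomotopy f 0).symm ⟨z, by simpa using hz.symm⟩⟩

/-- An epimorphism `A ⟶ B` induces a surjective quasi-isomorphism between the contractible complexes
`A = A` and `B = B` in degrees `n`, `n + 1`. Cochains need not commute with differentials, so a map
given in degree `n` alone can be lifted through it. -/
lemma IsSemiProjective.projective {P : Cpx R} (hP : IsSemiProjective P) (n : ℤ) :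
    Projective (P.X n) where
  factors {A B} g f hf := by
    have hr : (ComplexShape.up ℤ).Rel n (n + 1) := by simp
    have hne : n ≠ n + 1 := by lia
    have hac (A : ModuleCat.{u} R) : (double (𝟙 A) hr).Acyclic := by
      intro k
      by_cases h0 : k = n
      · subst h0
        rw [HomologicalComplex.exactAt_iff' _ (k - 1) k (k + 1) (by simp) (by simp)]
        have : IsZero ((double (𝟙 A) hr).X (k - 1)) :=
          isZero_double_X _ _ _ (by lia) (by lia)
        refine (ShortComplex.exact_iff_mono _ (this.eq_of_src _ _)).2 ?_
        change Mono ((double (𝟙 A) hr).d k (k + 1))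
        rw [double_d _ _ hne]
        infer_instance
      by_cases h1 : k = n + 1
      · subst h1
        rw [HomologicalComplex.exactAt_iff' _ n (n + 1) (n + 1 + 1) (by simp) (by simp)]
        have : IsZero ((double (𝟙 A) hr).X (n + 1 + 1)) :=
          isZero_double_X _ _ _ (by lia) (by lia)
        refine (ShortComplex.exact_iff_epi _ (this.eq_of_tgt _ _)).2 ?_
        change Epi ((double (𝟙 A) hr).d n (n + 1))
        rw [double_d _ _ hne]
        infer_instance
      · exact ShortComplex.exact_of_isZero_X₂ _ (isZero_double_X (𝟙 A) hr k h0 h1)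
    let β : double (𝟙 A) hr ⟶ double (𝟙 B) hr :=
      mkHomFromDouble hr hne (f ≫ (doubleXIso₀ (𝟙 B) hr).inv) (f ≫ (doubleXIso₁ (𝟙 B) hr hne).inv)
        (by simp [double_d _ _ hne]) (by simp [double_d_eq_zero₀ _ _ _ _ hne.symm])
    have hβ0 : (doubleXIso₀ (𝟙 A) hr).inv ≫ β.f n = f ≫ (doubleXIso₀ (𝟙 B) hr).inv := by
      simp [β, mkHomFromDouble_f₀]
    have hβ (k : ℤ) : Function.Surjective (β.f k) := by
      rw [← ModuleCat.epi_iff_surjective]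
      by_cases h0 : k = n
      · subst h0
        simp only [β, mkHomFromDouble_f₀]
        infer_instance
      · by_cases h1 : k = n + 1
        · subst h1
          simp only [β, mkHomFromDouble_f₁]
          infer_instance
        · exact (isZero_double_X _ hr k h0 h1).epi _
    have hq : QuasiIso β := by
      rw [quasiIso_iff]
      intro i
      rw [quasiIsoAt_iff_exactAt _ _ (hac A i)]
      exact hac B i
    obtain ⟨(z : HomComplex.Cochain P _ 0), hz⟩ := (hP β hβ hq).1 0
      (HomComplex.Cochain.single (g ≫ (doubleXIso₀ (𝟙 B) hr).inv) 0)
    have hz' := HomComplex.Cochain.congr_v (show z.comp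
      (HomComplex.Cochain.ofHom β) (add_zero 0) = _ from hz) n n (by simp)
    refine ⟨HomComplex.Cochain.v z n n (by simp) ≫ (doubleXIso₀ (𝟙 A) hr).hom, ?_⟩
    rw [← cancel_mono (doubleXIso₀ (𝟙 B) hr).inv, Category.assoc, Category.assoc, ← hβ0]
    rw [HomComplex.Cochain.comp_zero_cochain_v, HomComplex.Cochain.ofHom_v,
      HomComplex.Cochain.single_v] at hz'
    simpa using hz'

end

/-! ### Left adjoints of exact functors preserve semi-projectivity -/

section
variable {R S : Type u} [Ring R] [Ring S]

lemma acyclic_map (G : ModuleCat.{u} S ⥤ ModuleCat.{u} R) [G.Additive] [G.PreservesHomology]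
    {A : Cpx S} (hA : A.Acyclic) : ((G.mapHomologicalComplex _).obj A).Acyclic := fun i =>
  (hA i).map G

lemma isKProjective_map_of_adjunction {F : ModuleCat.{u} R ⥤ ModuleCat.{u} S}
    {G : ModuleCat.{u} S ⥤ ModuleCat.{u} R} (adj : F ⊣ G) [F.Additive] [G.Additive]
    [G.PreservesHomology] (P : Cpx R) [P.IsKProjective] :
    IsKProjective ((F.mapHomologicalComplex _).obj P) where
  nonempty_homotopy_zero {A} f hA := by
    -- The adjoint `g` of `f` lands in the acyclic complex `G A`, so it is null-homotopic, and `f`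
    -- is recovered as `F g` followed by the counit.
    let g : P ⟶ (G.mapHomologicalComplex _).obj A :=
      { f := fun i => adj.homEquiv _ _ (f.f i)
        comm' := fun i j _ => by
          have : F.map (P.d i j) ≫ f.f j = f.f i ≫ A.d i j := (f.comm i j).symm
          exact ((adj.homEquiv_naturality_right _ _).symm.trans
            (congrArg (adj.homEquiv (P.X i) (A.X j)) this.symm)).trans
            (adj.homEquiv_naturality_left _ _) }
    let ε : (F.mapHomologicalComplex _).obj ((G.mapHomologicalComplex _).obj A) ⟶ A :=
      { f := fun i => adj.counit.app (A.X i)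
        comm' := fun i j _ => (adj.counit.naturality (A.d i j)).symm }
    have hf : f = (F.mapHomologicalComplex _).map g ≫ ε := by
      ext1 i
      exact ((adj.homEquiv_counit (g := g.f i)).symm.trans (Equiv.symm_apply_apply _ _)).symm
    have h := IsKProjective.homotopyZero g (acyclic_map G hA)
    exact ⟨(Homotopy.ofEq hf).trans (((F.mapHomotopy h).compRight ε).trans
      (Homotopy.ofEq (by simp)))⟩

lemma IsSemiProjective.map_of_adjunction {F : ModuleCat.{u} R ⥤ ModuleCat.{u} S}
    {G : ModuleCat.{u} S ⥤ ModuleCat.{u} R} (adj : F ⊣ G) [F.Additive] [G.Additive]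
    [G.PreservesHomology] [G.PreservesEpimorphisms] {P : Cpx R} (hP : IsSemiProjective P) :
    IsSemiProjective ((F.mapHomologicalComplex _).obj P) := by
  have := hP.isKProjective
  have := isKProjective_map_of_adjunction adj P
  have (n : ℤ) : Projective (((F.mapHomologicalComplex (ComplexShape.up ℤ)).obj P).X n) :=
    adj.map_projective _ (hP.projective n)
  exact isSemiProjective_of_isKProjective _

end

/-! ### Quasi-projective dimension of a module -/

section
variable (R : Type u) [Ring R] (M : Type u) [AddCommGroup M] [Module R M]

/-- The existence of a bounded above quasi-projective resolution of the module `M`. -/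
def HasQuasiProjRes : Prop :=
  ∃ (P : Cpx R) (l : ℤ) (a : ℤ → ℕ), IsSemiProjective P ∧ IsBoundedAbove P ∧
    (∀ i < l, a i = 0) ∧ (∃ i, a i ≠ 0) ∧ ∀ n, Nonempty (hom P n ≃ₗ[R] (Fin (a n) → M))

variable {R M}

lemma nonempty_homology_single_equiv (k : ℤ) (hk : k = 0) :
    Nonempty (((single (ModuleCat.{u} R) (ComplexShape.up ℤ) 0).obj
      (ModuleCat.of R M)).homology k ≃ₗ[R] M) := by
  subst hk
  exact ⟨(singleObjHomologySelfIso (ComplexShape.up ℤ) 0 (ModuleCat.of R M)).toLinearEquiv⟩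

lemma subsingleton_homology_single (k : ℤ) (hk : k ≠ 0) :
    Subsingleton (((single (ModuleCat.{u} R) (ComplexShape.up ℤ) 0).obj
      (ModuleCat.of R M)).homology k) :=
  ModuleCat.subsingleton_of_isZero 
    (isZero_single_obj_homology _ _ _ _ hk)

open DirectSum in
/-- A direct sum with only one possibly nonzero summand. -/
lemma nonempty_directSum_equiv_component {ι : Type*} [DecidableEq ι] {N : ι → Type*}
    [∀ i, AddCommGroup (N i)] [∀ i, Module R (N i)] (i₀ : ι)
    (h : ∀ i, i ≠ i₀ → Subsingleton (N i)) : Nonempty ((⨁ i, N i) ≃ₗ[R] N i₀) := by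
  refine ⟨LinearEquiv.ofLinearMap (component R ι N i₀) (lof R ι N i₀) ?_ ?_⟩
  · ext x
    simp
  · refine DirectSum.linearMap_ext _ fun i => ?_
    by_cases hi : i = i₀
    · subst hi
      ext x : 1
      simp [component.lof_self]
    · have := h i hi
      ext x : 1
      rw [Subsingleton.elim x 0, map_zero, map_zero]

lemma nonempty_directSum_single_equiv {l : ℤ} (a : {i : ℤ // l ≤ i} → ℕ) (b : ℤ → ℕ)
    (hab : ∀ i (h : l ≤ i), b i = a ⟨i, h⟩) (hb : ∀ i, ¬ l ≤ i → b i = 0) (n : ℤ) :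
    Nonempty ((⨁ i : {i : ℤ // l ≤ i}, (Fin (a i) → hom ((single (ModuleCat.{u} R)
      (ComplexShape.up ℤ) 0).obj (ModuleCat.of R M)) (n - i.1))) ≃ₗ[R] (Fin (b n) → M)) := by
  have h0 (i : {i : ℤ // l ≤ i}) (hi : i.1 ≠ n) : Subsingleton (Fin (a i) → hom ((single
      (ModuleCat.{u} R) (ComplexShape.up ℤ) 0).obj (ModuleCat.of R M)) (n - i.1)) := by
    have := subsingleton_homology_single (R := R) (M := M) (-(n - i.1)) (by lia)
    infer_instance
  by_cases hn : l ≤ n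
  · obtain ⟨e⟩ := nonempty_directSum_equiv_component (R := R) (N := fun i : {i : ℤ // l ≤ i} =>
      (Fin (a i) → hom ((single (ModuleCat.{u} R) (ComplexShape.up ℤ) 0).obj
        (ModuleCat.of R M)) (n - i.1))) ⟨n, hn⟩ (fun i hi => h0 i fun h => hi (Subtype.ext h))
    obtain ⟨e'⟩ := nonempty_homology_single_equiv (R := R) (M := M) (-(n - n)) (by lia)
    rw [hab n hn]
    exact ⟨e ≪≫ₗ LinearEquiv.piCongrRight fun _ => e'⟩
  · rw [hb n hn]
    have (i : {i : ℤ // l ≤ i}) := h0 i (by have := i.2; lia)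
    exact ⟨LinearEquiv.ofSubsingleton _ _⟩

/-- `H(M)` sits in degree `0`, so in degree `n` only the summand `i = n` survives. Extending `a` by
zero to all of `ℤ` makes shifts such as `a (n - 1)` meaningful. -/
lemma isQuasiProjRes_single_iff (P : Cpx R) :
    IsQuasiProjRes ((single (ModuleCat.{u} R) (ComplexShape.up ℤ) 0).obj (ModuleCat.of R M)) P ↔
      IsSemiProjective P ∧ ∃ (l : ℤ) (a : ℤ → ℕ), (∀ i < l, a i = 0) ∧ (∃ i, a i ≠ 0) ∧
        ∀ n, Nonempty (hom P n ≃ₗ[R] (Fin (a n) → M)) := by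
  refine and_congr_right fun _ => exists_congr fun l => ⟨?_, ?_⟩
  · rintro ⟨a, ⟨i, hi⟩, h⟩
    refine ⟨fun j => if hj : l ≤ j then a ⟨j, hj⟩ else 0, fun j hj => dif_neg (by lia),
      ⟨i.1, by simpa [i.2] using hi⟩, fun n => ?_⟩
    obtain ⟨e⟩ := h n
    obtain ⟨e'⟩ := nonempty_directSum_single_equiv (R := R) (M := M) a
      (fun j => if hj : l ≤ j then a ⟨j, hj⟩ else 0) (fun j hj => dif_pos hj)
      (fun j hj => dif_neg hj) n
    exact ⟨e ≪≫ₗ e'⟩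
  · rintro ⟨a, ha, ⟨i, hi⟩, h⟩
    refine ⟨fun j => a j.1, ⟨⟨i, not_lt.1 fun hl => hi (ha i hl)⟩, hi⟩, fun n => ?_⟩
    obtain ⟨e⟩ := h n
    obtain ⟨e'⟩ := nonempty_directSum_single_equiv (R := R) (M := M) (l := l) (fun j => a j.1)
      a (fun _ _ => rfl) (fun j hj => ha j (not_le.1 hj)) n
    exact ⟨e ≪≫ₗ e'.symm⟩

lemma sup_sub_hsup_lt_top {P : Cpx R} (hP : IsBoundedAbove P) {i : ℤ}
    (hi : Nontrivial (hom P i)) : sup P - hsup P < ⊤ := by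
  have h1 : sup P ≠ ⊤ := by
    obtain ⟨n, hn⟩ := hP
    refine ne_top_of_le_ne_top (EReal.coe_ne_top (n : ℝ)) (sSup_le ?_)
    rintro _ ⟨j, hj, rfl⟩
    have : j ≤ n := not_lt.1 fun h => not_subsingleton_iff_nontrivial.2 hj (hn j h)
    exact_mod_cast this
  have h2 : hsup P ≠ ⊥ :=
    ne_bot_of_le_ne_bot (EReal.coe_ne_bot (i : ℝ)) (le_sSup ⟨i, hi, rfl⟩)
  rw [sub_eq_add_neg, lt_top_iff_ne_top]
  exact EReal.add_ne_top h1 (by simpa using h2)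

/-- Some `a_i ≠ 0` forces `H_i(P) ≠ 0`, so `hsup P` is not `⊥`, and a single resolution already
makes the infimum less than `⊤`. -/
lemma qpd_lt_top_iff [Nontrivial M] : qpd R M < ⊤ ↔ HasQuasiProjRes R M := by
  have hna : ¬ ((single (ModuleCat.{u} R) (ComplexShape.up ℤ) 0).obj
      (ModuleCat.of R M)).Acyclic := fun h => by
    obtain ⟨e⟩ := nonempty_homology_single_equiv (R := R) (M := M) 0 rfl
    have := ModuleCat.subsingleton_of_isZero (h 0).isZero_homology
    exact not_subsingleton M e.symm.injective.subsingleton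
  rw [qpd, qpdCpx, if_neg hna, sInf_lt_iff]
  constructor
  · rintro ⟨_, ⟨P, hP, hb, rfl⟩, -⟩
    obtain ⟨h, l, a, ha⟩ := (isQuasiProjRes_single_iff P).1 hP
    exact ⟨P, l, a, h, hb, ha⟩
  · rintro ⟨P, l, a, h, hb, ha, ⟨i, hi⟩, hn⟩
    refine ⟨_, ⟨P, (isQuasiProjRes_single_iff P).2 ⟨h, l, a, ha, ⟨i, hi⟩, hn⟩, hb, rfl⟩,
      sup_sub_hsup_lt_top hb (i := i) ?_⟩
    obtain ⟨e⟩ := hn i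
    have : Nonempty (Fin (a i)) := ⟨⟨0, Nat.pos_of_ne_zero hi⟩⟩
    exact e.toEquiv.nontrivial

end

/-! ### Split self-extensions and change of rings -/

section

/-- Every extension of a finite power of `M` by a finite power of `M` splits. -/
def SelfExtensionsSplit (R : Type u) [Ring R] (M : Type u) [AddCommGroup M] [Module R M] : Prop :=
  ∀ (a b : ℕ) (E : Type u) [AddCommGroup E] [Module R E] (i : (Fin a → M) →ₗ[R] E)
    (p : E →ₗ[R] (Fin b → M)), Function.Injective i → Function.Exact i p →
    Function.Surjective p → ∃ s : (Fin b → M) →ₗ[R] E, p ∘ₗ s = LinearMap.id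

lemma SelfExtensionsSplit.nonempty_linearEquiv {R : Type u} [Ring R] {M : Type u}
    [AddCommGroup M] [Module R M] (h : SelfExtensionsSplit R M) {a b : ℕ} {A E B : Type u}
    [AddCommGroup A] [AddCommGroup E] [AddCommGroup B] [Module R A] [Module R E] [Module R B]
    (eA : A ≃ₗ[R] (Fin a → M)) (eB : B ≃ₗ[R] (Fin b → M)) {i : A →ₗ[R] E} {p : E →ₗ[R] B}
    (hi : Function.Injective i) (hip : Function.Exact i p) (hp : Function.Surjective p) :
    Nonempty (E ≃ₗ[R] (Fin (a + b) → M)) := by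
  have hex : Function.Exact (i ∘ₗ eA.symm.toLinearMap) (eB.toLinearMap ∘ₗ p) := by
    intro y
    have := hip y
    simp only [LinearMap.comp_apply, LinearEquiv.coe_coe, EmbeddingLike.map_eq_zero_iff]
    rw [this]
    constructor
    · rintro ⟨z, rfl⟩
      exact ⟨eA z, by simp⟩
    · rintro ⟨z, rfl⟩
      exact ⟨_, rfl⟩
  have hinj : Function.Injective (i ∘ₗ eA.symm.toLinearMap) := hi.comp eA.symm.injective
  obtain ⟨s, hs⟩ := h a b E _ _ hinj hex (eB.surjective.comp hp)
  have e := (hex.splitSurjectiveEquiv hinj ⟨s, hs⟩).1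
  exact ⟨e ≪≫ₗ (LinearEquiv.sumArrowLequivProdArrow (Fin a) (Fin b) R M).symm ≪≫ₗ
    LinearEquiv.funCongrLeft R M finSumFinEquiv.symm⟩

variable {R S : Type u} [CommRing R] [CommRing S] [Algebra R S]

/-- An `R`-linear section is automatically `S`-linear; this is how the `Ext` hypothesis descends
through the induction. -/
lemma SelfExtensionsSplit.of_surjective (hf : Function.Surjective (algebraMap R S))
    {M : Type u} [AddCommGroup M] [Module R M] [Module S M] [IsScalarTower R S M]
    (h : SelfExtensionsSplit R M) : SelfExtensionsSplit S M := by
  intro a b E _ _ i p hi hip hp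
  let _ : Module R E := Module.compHom E (algebraMap R S)
  have : IsScalarTower R S E := IsScalarTower.of_algebraMap_smul fun _ _ => rfl
  obtain ⟨s, hs⟩ := h a b E (i.restrictScalars R) (p.restrictScalars R) hi hip hp
  refine ⟨{ s with map_smul' := fun r m => ?_ }, LinearMap.ext fun m => congr($hs m)⟩
  obtain ⟨r, rfl⟩ := hf r
  simp

lemma nonempty_linearEquiv_of_restrictScalars (hf : Function.Surjective (algebraMap R S))
    {M : Type u} [AddCommGroup M] [Module R M] [Module S M] [IsScalarTower R S M]
    (A : ModuleCat.{u} S) (e : (ModuleCat.restrictScalars (algebraMap R S)).obj A ≃ₗ[R] M) :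
    Nonempty (A ≃ₗ[S] M) := by
  refine ⟨{ e.toAddEquiv with map_smul' := fun s m => ?_ }⟩
  obtain ⟨r, rfl⟩ := hf s
  exact (e.map_smul r m).trans (algebraMap_smul S r _).symm

/-- Exact functors commute with homology. -/
noncomputable def mapHomologyIso' {R S : Type u} [Ring R] [Ring S]
    (G : ModuleCat.{u} S ⥤ ModuleCat.{u} R) [G.Additive] [G.PreservesHomology] (A : Cpx S) (n : ℤ) :
    ((G.mapHomologicalComplex _).obj A).homology n ≅ G.obj (A.homology n) :=
  (A.sc n).mapHomologyIso G

lemma isBoundedAbove_map {R S : Type u} [Ring R] [Ring S]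
    (F : ModuleCat.{u} R ⥤ ModuleCat.{u} S) [F.Additive] {P : Cpx R} (hP : IsBoundedAbove P) :
    IsBoundedAbove ((F.mapHomologicalComplex _).obj P) := by
  obtain ⟨n, hn⟩ := hP
  refine ⟨n, fun i hi => ModuleCat.subsingleton_of_isZero (F.map_isZero ?_)⟩
  have := hn i hi
  exact ModuleCat.isZero_of_subsingleton _

lemma HasQuasiProjRes.of_ringEquiv {R S : Type u} [Ring R] [Ring S] (e : S ≃+* R) {M : Type u}
    [AddCommGroup M] [Module R M] [Module S M] (he : ∀ (s : S) (m : M), e s • m = s • m)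
    (h : HasQuasiProjRes R M) : HasQuasiProjRes S M := by
  obtain ⟨P, l, a, hP, hb, ha, hne, hn⟩ := h
  let E := ModuleCat.restrictScalarsEquivalenceOfRingEquiv e
  have : E.functor.Additive := inferInstanceAs (ModuleCat.restrictScalars e.toRingHom).Additive
  have : E.inverse.Additive :=
    inferInstanceAs (ModuleCat.restrictScalars (e.symm : R →+* S)).Additive
  refine ⟨(E.functor.mapHomologicalComplex _).obj P, l, a, hP.map_of_adjunction E.toAdjunction,
    isBoundedAbove_map _ hb, ha, hne, fun n => ?_⟩
  obtain ⟨f⟩ := hn n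
  refine ⟨(mapHomologyIso' E.functor P (-n)).toLinearEquiv ≪≫ₗ
    { f.toAddEquiv with map_smul' := fun s m => ?_ }⟩
  refine (f.map_smul (e s) m).trans ?_
  ext i
  exact he s _

variable {x : R}

/-! ### Reduction modulo a regular element -/

section extend

variable (R S) in
/-- The algebra map as a morphism of modules. -/
noncomputable def algebraMapHom : ModuleCat.of R R ⟶
    (ModuleCat.restrictScalars (algebraMap R S)).obj (ModuleCat.of S S) :=
  ModuleCat.ofHom
    (Y := (ModuleCat.restrictScalars (algebraMap R S)).obj (ModuleCat.of S S))
    { toFun := fun r => algebraMap R S r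
      map_add' := map_add _
      map_smul' := fun r t => map_mul (algebraMap R S) r t }

open TensorProduct in
lemma rTensor_algebraMapHom_one_tmul (X : ModuleCat.{u} R) (m : X) :
    (algebraMapHom R S).hom.rTensor X ((1 : R) ⊗ₜ m) =
      (ModuleCat.extendRestrictScalarsAdj (algebraMap R S)).unit.app X m := by
  have : (algebraMapHom R S).hom (1 : R) = (1 : S) := map_one (algebraMap R S)
  rw [LinearMap.rTensor_tmul, this]
  rfl

lemma unit_surjective (hf : Function.Surjective (algebraMap R S)) (X : ModuleCat.{u} R) :
    Function.Surjective ((ModuleCat.extendRestrictScalarsAdj (algebraMap R S)).unit.app X) := by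
  intro y
  obtain ⟨t, rfl⟩ := LinearMap.rTensor_surjective X (g := (algebraMapHom R S).hom) hf y
  refine ⟨TensorProduct.lid R X t, ?_⟩
  rw [← rTensor_algebraMapHom_one_tmul]
  exact congrArg _ ((TensorProduct.lid R X).symm_apply_apply t)

/-- Right exactness of the tensor product, applied to `R → R → S → 0` with first map multiplication
by `x`. -/
lemma exists_smul_of_unit_eq_zero (hf : Function.Surjective (algebraMap R S))
    (hx : ∀ r, algebraMap R S r = 0 ↔ x ∣ r) (X : ModuleCat.{u} R) (m : X)
    (hm : (ModuleCat.extendRestrictScalarsAdj (algebraMap R S)).unit.app X m = 0) :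
    ∃ m', x • m' = m := by
  have hex : Function.Exact (LinearMap.lsmul R R x) (algebraMapHom R S).hom := fun r => by
    refine (hx r).trans ⟨?_, ?_⟩
    · rintro ⟨t, rfl⟩
      exact ⟨t, rfl⟩
    · rintro ⟨t, rfl⟩
      exact ⟨t, rfl⟩
  rw [← rTensor_algebraMapHom_one_tmul] at hm
  obtain ⟨t, ht⟩ := (rTensor_exact X hex hf _).1 hm
  obtain ⟨m', rfl⟩ := (TensorProduct.lid R X).symm.surjective t
  refine ⟨m', ?_⟩
  have := congrArg (TensorProduct.lid R X) ht
  simpa using this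

lemma unit_smul_eq_zero (hx : ∀ r, algebraMap R S r = 0 ↔ x ∣ r) (X : ModuleCat.{u} R) (m : X) :
    (ModuleCat.extendRestrictScalarsAdj (algebraMap R S)).unit.app X (x • m) = 0 := by
  rw [map_smul]
  refine (ModuleCat.restrictScalars.smul_def (algebraMap R S) x _).trans ?_
  rw [(hx x).2 dvd_rfl]
  exact zero_smul S _

lemma injective_smul_of_projective (hx : IsSMulRegular R x) (X : ModuleCat.{u} R) [Projective X] :
    Function.Injective (fun m : X => x • m) := by
  have : Module.Projective R X := (IsProjective.iff_projective (R := R) X).2 ‹_›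
  have := Module.Flat.rTensor_preserves_injective_linearMap (M := X) (LinearMap.lsmul R R x) hx
  intro m m' h
  have h2 := @this (1 ⊗ₜ m) (1 ⊗ₜ m') (by
    apply (TensorProduct.lid R X).injective
    simpa using h)
  simpa using congrArg (TensorProduct.lid R X) h2

lemma homologyMap_smul_id (P : Cpx R) (r : R) (n : ℤ) :
    homologyMap (r • 𝟙 P) n = r • 𝟙 (P.homology n) :=
  (ShortComplex.homologyMap_smul (𝟙 (P.sc n)) r).trans
    (congrArg (r • ·) (ShortComplex.homologyMap_id (P.sc n)))

lemma HasQuasiProjRes.of_surjective (hf : Function.Surjective (algebraMap R S))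
    (hker : ∀ r, algebraMap R S r = 0 ↔ x ∣ r) (hx : IsSMulRegular R x)
    {M : Type u} [AddCommGroup M] [Module R M] [Module S M] [IsScalarTower R S M]
    (hs : SelfExtensionsSplit R M) (h : HasQuasiProjRes R M) : HasQuasiProjRes S M := by
  obtain ⟨P, l, a, hP, hb, ha, ⟨i, hi⟩, hn⟩ := h
  let adj := ModuleCat.extendRestrictScalarsAdj.{u, u, u} (algebraMap R S)
  let F := ModuleCat.extendScalars.{u, u, u} (algebraMap R S)
  let G := ModuleCat.restrictScalars.{u} (algebraMap R S)
  have : F.Additive := adj.left_adjoint_additive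
  let FP := (F.mapHomologicalComplex (ComplexShape.up ℤ)).obj P
  let GFP := (G.mapHomologicalComplex (ComplexShape.up ℤ)).obj FP
  let η : P ⟶ GFP :=
    { f := fun n => adj.unit.app (P.X n)
      comm' := fun n m _ => (adj.unit.naturality (P.d n m)).symm }
  have hz : (x • 𝟙 P) ≫ η = 0 := by
    ext n m
    exact unit_smul_eq_zero hker (P.X n) m
  let T : ShortComplex (Cpx R) := ShortComplex.mk (x • 𝟙 P) η hz
  have hT : T.ShortExact := by
    refine shortExact_of_degreewise_shortExact _ fun n => ?_
    have := hP.projective n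
    refine ModuleCat.shortComplex_shortExact _ (fun m => ⟨fun hm => ?_, ?_⟩)
      (injective_smul_of_projective hx (P.X n)) (unit_surjective hf (P.X n))
    · exact exists_smul_of_unit_eq_zero hf hker (P.X n) m hm
    · rintro ⟨m, rfl⟩
      exact unit_smul_eq_zero hker (P.X n) m
  -- `H_n(P) ≅ M^{a_n}`, and `x` acts on `M` through its image in `S`, which is zero.
  have hx0 (n : ℤ) : homologyMap T.f (-n) = 0 := by
    refine (homologyMap_smul_id P x (-n)).trans ?_
    obtain ⟨e⟩ := hn n
    ext m
    apply e.injective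
    change e (x • m) = e 0
    rw [map_smul, map_zero]
    ext j
    change x • (e m j) = 0
    rw [← algebraMap_smul S x, (hker x).2 dvd_rfl, zero_smul]
  refine ⟨FP, l, fun n => a n + a (n - 1), hP.map_of_adjunction adj, isBoundedAbove_map F hb,
    fun n hl => by simp [ha n hl, ha (n - 1) (by lia)], ⟨i, by lia⟩, fun n => ?_⟩
  obtain ⟨eA⟩ := hn n
  obtain ⟨eB⟩ := hn (n - 1)
  -- The connecting map goes from homological degree `n` to `n - 1`; vanishing of `x` on homology
  -- makes the neighbouring maps a monomorphism and an epimorphism.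
  have hr : (ComplexShape.up ℤ).Rel (-n) (-(n - 1)) := by simp; lia
  have hm : Mono (homologyMap T.g (-n)) := (hT.homology_exact₂ (-n)).mono_g (hx0 _)
  have : Epi (hT.δ (-n) (-(n - 1)) hr) := (hT.homology_exact₁ _ _ hr).epi_f (hx0 _)
  obtain ⟨e⟩ := hs.nonempty_linearEquiv eA eB (i := (homologyMap T.g (-n)).hom)
    (p := (hT.δ (-n) (-(n - 1)) hr).hom) ((ModuleCat.mono_iff_injective _).1 hm)
    ((ShortComplex.ShortExact.moduleCat_exact_iff_function_exact _).1
      (hT.homology_exact₃ _ _ hr)) ((ModuleCat.epi_iff_surjective _).1 ‹_›)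
  exact nonempty_linearEquiv_of_restrictScalars hf _
    ((mapHomologyIso' G FP (-n)).toLinearEquiv.symm ≪≫ₗ e)

end extend
end

/-! ### Truncating a K-projective complex with bounded homology -/

section truncation
variable {R : Type u} [Ring R]

lemma πTruncGE_f_eq (P : Cpx R) (m : ℤ) :
    (P.πTruncGE m).f m = P.pOpcycles m ≫ (P.truncGEXIsoOpcycles m).inv := by
  have h0 : (ComplexShape.embeddingUpIntGE m).f 0 = m := by simp
  have hb : (ComplexShape.embeddingUpIntGE m).BoundaryGE 0 := by
    rw [ComplexShape.boundaryGE_embeddingUpIntGE_iff]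
  refine (ComplexShape.Embedding.liftExtend_f _ _
    (P.restrictionToTruncGE'_hasLift (ComplexShape.embeddingUpIntGE m)) h0).trans ?_
  rw [restrictionToTruncGE'_f_eq_iso_hom_pOpcycles_iso_inv P _ h0 hb, Category.assoc,
    Category.assoc, Iso.inv_hom_id_assoc]
  rfl

/-- The projection of `P` onto its acyclic truncation is null-homotopic. The truncation vanishes
below `m`, so in degree `m` the homotopy retracts `P.X (m + 1)` onto the opcycles. -/
lemma projective_opcycles (P : Cpx R) [P.IsKProjective] (m : ℤ) [P.IsLE (m - 1)]
    [Projective (P.X (m + 1))] : Projective (P.opcycles m) := by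
  have hac : (P.truncGE m).Acyclic := (P.acyclic_truncGE_iff (m - 1) m).2 inferInstance
  have h := IsKProjective.homotopyZero (P.πTruncGE m) hac
  have hc := h.comm m
  rw [dNext_eq h.hom (show (ComplexShape.up ℤ).Rel m (m + 1) by simp),
    prevD_eq h.hom (show (ComplexShape.up ℤ).Rel (m - 1) m by simp),
    ((P.truncGE m).isZero_of_isStrictlyGE m (m - 1)).eq_of_tgt (h.hom m (m - 1)) 0,
    zero_comp, add_zero, HomologicalComplex.zero_f, add_zero, πTruncGE_f_eq] at hc
  have hr : P.fromOpcycles m (m + 1) ≫ h.hom (m + 1) m ≫ (P.truncGEXIsoOpcycles m).hom = 𝟙 _ := by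
    rw [← cancel_epi (P.pOpcycles m), p_fromOpcycles_assoc, ← Category.assoc, ← hc]
    simp
  exact Retract.projective ⟨_, _, hr⟩

/-- Exactness at `m` makes the cycles the kernel of the projection of `P.X m` onto its projective
module of opcycles. -/
lemma projective_cycles (P : Cpx R) [P.IsKProjective] [∀ n, Projective (P.X n)] (m : ℤ)
    [P.IsLE (m - 1)] : Projective (P.cycles m) := by
  have := projective_opcycles P m
  have hw : P.iCycles m ≫ P.pOpcycles m = 0 := by
    have := (P.exactAt_of_isLE (m - 1) m).isZero_homology
    rw [← homology_π_ι, this.eq_of_tgt (P.homologyπ m) 0, zero_comp]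
  have hS : (ShortComplex.mk _ _ hw).ShortExact := by
    refine ⟨ShortComplex.exact_of_f_is_kernel _ ?_⟩
    refine KernelFork.IsLimit.ofι' _ _ fun {A} k hk => ?_
    have hk' : k ≫ P.d m (m + 1) = 0 := by
      rw [← P.p_fromOpcycles, ← Category.assoc]
      exact (congrArg (· ≫ P.fromOpcycles m (m + 1)) hk).trans zero_comp
    exact ⟨P.liftCycles k (m + 1) (by simp) hk', P.liftCycles_i k (m + 1) (by simp) hk'⟩
  have h2 : Projective (P.X m) := inferInstance
  rw [projective_iff_hasProjectiveDimensionLT_one] at this h2 ⊢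
  exact hS.hasProjectiveDimensionLT_X₁ 1 h2 (hasProjectiveDimensionLT_of_ge _ 1 _ (by simp))

lemma projective_truncLE (P : Cpx R) [P.IsKProjective] [∀ n, Projective (P.X n)] (m : ℤ)
    [P.IsLE (m - 1)] (n : ℤ) : Projective ((P.truncLE m).X n) := by
  rcases lt_trichotomy n m with h | rfl | h
  · exact Projective.of_iso (P.truncLEXIso m n h).symm inferInstance
  · exact Projective.of_iso (P.truncLEXIsoCycles n).symm (projective_cycles P n)
  · exact Projective.of_iso ((isZero_zero _).iso ((P.truncLE m).isZero_of_isStrictlyLE m n))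
      inferInstance

end truncation

/-! ### Projective dimension of projective `R/(x)`-modules over `R` -/

section resolution
variable {R S : Type u} [CommRing R] [CommRing S] [Algebra R S] {x : R}

lemma hasProjectiveDimensionLT_two_free (hf : Function.Surjective (algebraMap R S))
    (hker : ∀ r, algebraMap R S r = 0 ↔ x ∣ r) (hx : IsSMulRegular R x) (I : Type u) :
    HasProjectiveDimensionLT (ModuleCat.of R (I →₀ S)) 2 := by
  have hw : Finsupp.mapRange.linearMap (Algebra.linearMap R S) ∘ₗ
      LinearMap.lsmul R (I →₀ R) x = 0 := by
    ext i j
    simp [(hker x).2 dvd_rfl]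
  have hex : Function.Exact (LinearMap.lsmul R (I →₀ R) x)
      (Finsupp.mapRange.linearMap (α := I) (Algebra.linearMap R S)) := by
    intro t
    refine ⟨fun ht => ?_, ?_⟩
    · have hd (i : I) : x ∣ t i := (hker _).1 (DFunLike.congr_fun ht i)
      choose g hg using hd
      classical
      refine ⟨Finsupp.onFinset t.support (fun i => if t i = 0 then 0 else g i) (by simp; tauto),
        Finsupp.ext fun i => ?_⟩
      change x • (if t i = 0 then 0 else g i) = t i
      split_ifs with h
      · simp [h]
      · exact (hg i).symm
    · rintro ⟨t, rfl⟩
      exact congr($hw t)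
  have hinj : Function.Injective (LinearMap.lsmul R (I →₀ R) x) := fun t t' h =>
    Finsupp.ext fun i => hx (DFunLike.congr_fun h i)
  have hS : (ShortComplex.moduleCatMk (LinearMap.lsmul R (I →₀ R) x)
      (Finsupp.mapRange.linearMap (Algebra.linearMap R S)) hw).ShortExact :=
    ModuleCat.shortComplex_shortExact _ hex hinj (Finsupp.mapRange_surjective _ (map_zero _) hf)
  have hp : HasProjectiveDimensionLT (ModuleCat.of R (I →₀ R)) 1 := by
    rw [← projective_iff_hasProjectiveDimensionLT_one]
    exact (IsProjective.iff_projective (R := R) (I →₀ R)).1 inferInstance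
  exact hS.hasProjectiveDimensionLT_X₃ 1 hp (@hasProjectiveDimensionLT_of_ge _ _ _ _ 1 2 (by simp) hp)

lemma hasProjectiveDimensionLT_two (hf : Function.Surjective (algebraMap R S))
    (hker : ∀ r, algebraMap R S r = 0 ↔ x ∣ r) (hx : IsSMulRegular R x) (N : Type u)
    [AddCommGroup N] [Module R N] [Module S N] [IsScalarTower R S N] [Module.Projective S N] :
    HasProjectiveDimensionLT (ModuleCat.of R N) 2 := by
  obtain ⟨s, hs⟩ := Module.projective_def'.1 (inferInstance : Module.Projective S N)
  have := hasProjectiveDimensionLT_two_free hf hker hx N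
  refine Retract.hasProjectiveDimensionLT (Y := ModuleCat.of R (N →₀ S))
    ⟨ModuleCat.ofHom (s.restrictScalars R),
      ModuleCat.ofHom ((Finsupp.linearCombination S id).restrictScalars R), ?_⟩ 2
  ext m
  exact congr($hs m)

/-- A projective module over `R/(x)`, with `x` regular, has a projective resolution of length one
over `R`. -/
lemma exists_projective_cover (hf : Function.Surjective (algebraMap R S))
    (hker : ∀ r, algebraMap R S r = 0 ↔ x ∣ r) (hx : IsSMulRegular R x) (N : Type u)
    [AddCommGroup N] [Module R N] [Module S N] [IsScalarTower R S N] [Module.Projective S N] :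
    ∃ (F : ModuleCat.{u} R) (π : F →ₗ[R] N), Function.Surjective π ∧ Module.Projective R F ∧
      Module.Projective R (LinearMap.ker π) ∧ (Subsingleton N → Subsingleton F) := by
  have hsurj : Function.Surjective
      (Finsupp.linearCombination R (Subtype.val : {n : N // n ≠ 0} → N)) := fun n => by
    by_cases hn : n = 0
    · exact ⟨0, by simp [hn]⟩
    · exact ⟨Finsupp.single ⟨n, hn⟩ 1, by simp⟩
  -- Only nonzero elements serve as generators, so that the zero module gets the zero cover and
  -- boundedness is preserved.
  refine ⟨ModuleCat.of R ({n : N // n ≠ 0} →₀ R), _, hsurj, inferInstance, ?_, fun h => ?_⟩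
  · have hp : HasProjectiveDimensionLT (ModuleCat.of R ({n : N // n ≠ 0} →₀ R)) 1 := by
      rw [← projective_iff_hasProjectiveDimensionLT_one]
      exact (IsProjective.iff_projective (R := R) ({n : N // n ≠ 0} →₀ R)).1 inferInstance
    have := (LinearMap.shortExact_shortComplexKer hsurj).hasProjectiveDimensionLT_X₁ 1 hp
      (hasProjectiveDimensionLT_two hf hker hx N)
    rw [← projective_iff_hasProjectiveDimensionLT_one] at this
    exact (IsProjective.iff_projective (R := R) _).2 this
  · have : IsEmpty {n : N // n ≠ 0} := ⟨fun n => n.2 (Subsingleton.elim _ _)⟩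
    exact inferInstanceAs (Subsingleton ({n : N // n ≠ 0} →₀ R))

end resolution

/-! ### Resolving a complex with given projective covers of its terms -/

section
variable {R : Type u} [Ring R]

lemma quasiIso_of_surjective {K L : Cpx R} (φ : K ⟶ L)
    (hs : ∀ n, Function.Surjective (φ.f n))
    (h : ∀ n (z : K.X (n + 1)), φ.f (n + 1) z = 0 → K.d (n + 1) (n + 1 + 1) z = 0 →
      ∃ y : K.X n, φ.f n y = 0 ∧ K.d n (n + 1) y = z) : QuasiIso φ := by
  have hS := shortExact_kernel φ hs
  refine quasiIso_g_of_acyclic_X₁ hS fun n => ?_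
  obtain ⟨n, rfl⟩ : ∃ m, n = m + 1 := ⟨n - 1, by lia⟩
  have hSd (q : ℤ) := hS.map_of_exact (HomologicalComplex.eval _ _ q)
  have hinj (q : ℤ) : Function.Injective ((kernel.ι φ).f q) :=
    (ModuleCat.mono_iff_injective _).1 (hSd q).mono_f
  rw [HomologicalComplex.exactAt_iff' _ n (n + 1) (n + 1 + 1) (by simp) (by simp),
    ShortComplex.moduleCat_exact_iff]
  intro (z : (kernel φ).X (n + 1)) (hz : (kernel φ).d (n + 1) (n + 1 + 1) z = 0)
  obtain ⟨y, hy, hyz⟩ := h n ((kernel.ι φ).f (n + 1) z)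
    congr(($(kernel.condition φ)).f (n + 1) z) (by
      refine congr($((kernel.ι φ).comm (n + 1) (n + 1 + 1)) z).trans ?_
      change (kernel.ι φ).f (n + 1 + 1) ((kernel φ).d (n + 1) (n + 1 + 1) z) = 0
      rw [hz, map_zero])
  obtain ⟨w, hw⟩ := (ShortComplex.moduleCat_exact_iff _).1 (hSd n).exact y hy
  refine ⟨w, hinj (n + 1) ?_⟩
  refine (congr($((kernel.ι φ).comm n (n + 1)) w)).symm.trans ?_
  refine Eq.trans ?_ hyz
  exact congrArg (K.d n (n + 1)) hw

/-- A complex `C` with termwise surjections `π` from projective modules is quasi-isomorphic to a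
complex with terms `F j × ker (π (j + 1))`. -/
lemma exists_resolution (C : Cpx R) (F : ℤ → ModuleCat.{u} R) (π : ∀ j, F j →ₗ[R] C.X j)
    (hπ : ∀ j, Function.Surjective (π j)) (hF : ∀ j, Module.Projective R (F j)) :
    ∃ (Q : Cpx R) (φ : Q ⟶ C), QuasiIso φ ∧
      ∀ j, Nonempty (Q.X j ≃ₗ[R] F j × LinearMap.ker (π (j + 1))) := by
  have hdt (j : ℤ) : ∃ t : F j →ₗ[R] F (j + 1), π (j + 1) ∘ₗ t = (C.d j (j + 1)).hom ∘ₗ π j :=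
    Module.projective_lifting_property _ _ (hπ (j + 1))
  choose t ht using hdt
  have ht' (j : ℤ) (a : F j) : π (j + 1) (t j a) = C.d j (j + 1) (π j a) := congr($(ht j) a)
  have hker (j : ℤ) (a : F j) (b : LinearMap.ker (π (j + 1))) :
      -(t (j + 1) (t j a + b.1)) ∈ LinearMap.ker (π (j + 1 + 1)) := by
    have hb : π (j + 1) b.1 = 0 := b.2
    rw [LinearMap.mem_ker, map_neg, ht', map_add, hb, add_zero, ht', neg_eq_zero]
    exact congr($(C.d_comp_d j (j + 1) (j + 1 + 1)) (π j a))
  -- The lifts `t` of the differential need not satisfy `t² = 0`. The second component corrects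
  -- this: the output `(a', -t a')` has `t a' + (-t a') = 0`, whence `D² = 0`.
  let D (j : ℤ) : (F j × LinearMap.ker (π (j + 1))) →ₗ[R]
      (F (j + 1) × LinearMap.ker (π (j + 1 + 1))) :=
    { toFun := fun p => (t j p.1 + p.2.1, ⟨-(t (j + 1) (t j p.1 + p.2.1)), hker j p.1 p.2⟩)
      map_add' := fun p q => by
        ext <;> simp <;> abel
      map_smul' := fun r p => by
        ext <;> simp }
  have hDD (j : ℤ) : D (j + 1) ∘ₗ D j = 0 := by
    refine LinearMap.ext fun p => Prod.ext ?_ (Subtype.ext ?_)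
    · exact add_neg_cancel (t (j + 1) (t j p.1 + p.2.1))
    · change -(t (j + 1 + 1) (t (j + 1) (t j p.1 + p.2.1) + -(t (j + 1) (t j p.1 + p.2.1)))) = 0
      rw [add_neg_cancel, map_zero, neg_zero]
  let Q : Cpx R := CochainComplex.of
    (fun j => ModuleCat.of R (F j × LinearMap.ker (π (j + 1)))) (fun j => ModuleCat.ofHom (D j))
    (fun j => ModuleCat.hom_ext (hDD j))
  have hQd (j : ℤ) : Q.d j (j + 1) = ModuleCat.ofHom (D j) :=
    CochainComplex.of_d (fun j => ModuleCat.of R (F j × LinearMap.ker (π (j + 1))))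
      (fun j => ModuleCat.ofHom (D j)) j
  let φ : Q ⟶ C :=
    { f := fun j => ModuleCat.ofHom (X := F j × LinearMap.ker (π (j + 1)))
        (π j ∘ₗ LinearMap.fst R _ _)
      comm' := fun i j hij => by
        obtain rfl : i + 1 = j := hij
        rw [hQd]
        refine ModuleCat.hom_ext
          (LinearMap.ext fun (p : F i × LinearMap.ker (π (i + 1))) => ?_)
        change C.d i (i + 1) (π i p.1) = π (i + 1) (t i p.1 + p.2.1)
        have hb : π (i + 1) p.2.1 = 0 := p.2.2
        rw [map_add, hb, add_zero, ht'] }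
  refine ⟨Q, φ, quasiIso_of_surjective φ (fun n y => ?_) fun n z hz hdz => ?_,
    fun j => ⟨LinearEquiv.refl R _⟩⟩
  · obtain ⟨a, rfl⟩ := hπ n y
    exact ⟨(a, 0), rfl⟩
  · rw [hQd] at hdz ⊢
    obtain ⟨a, b⟩ := z
    replace hz : π (n + 1) a = 0 := hz
    have hab : t (n + 1) a + b.1 = 0 := congrArg Prod.fst hdz
    -- A cycle `(a, b)` in the kernel of `φ` satisfies `b = -t a`, so it equals `D (0, a)`.
    refine ⟨(0, ⟨a, hz⟩), map_zero (π n), ?_⟩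
    refine Prod.ext ?_ (Subtype.ext ?_)
    · change t n 0 + a = a
      rw [map_zero, zero_add]
    · change -(t (n + 1) (t n 0 + a)) = b.1
      rw [map_zero, zero_add, neg_eq_iff_add_eq_zero, hab]

end

/-! ### Restriction of scalars from `R/(x)` to `R` -/

section
variable {R S : Type u} [CommRing R] [CommRing S] [Algebra R S] {x : R}

lemma exists_projective_cover_restrictScalars (hf : Function.Surjective (algebraMap R S))
    (hker : ∀ r, algebraMap R S r = 0 ↔ x ∣ r) (hx : IsSMulRegular R x) (X : ModuleCat.{u} S)
    [hX : Projective X] :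
    ∃ (F : ModuleCat.{u} R) (π : F →ₗ[R] (ModuleCat.restrictScalars (algebraMap R S)).obj X),
      Function.Surjective π ∧ Module.Projective R F ∧ Module.Projective R (LinearMap.ker π) ∧
      (Subsingleton X → Subsingleton F) := by
  let _ : Module S ((ModuleCat.restrictScalars (algebraMap R S)).obj X) := X.isModule
  have : Module.Projective S ((ModuleCat.restrictScalars (algebraMap R S)).obj X) :=
    (IsProjective.iff_projective (R := S) X).2 hX
  have : IsScalarTower R S ((ModuleCat.restrictScalars (algebraMap R S)).obj X) :=
    IsScalarTower.of_algebraMap_smul fun _ _ => rfl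
  exact exists_projective_cover hf hker hx ((ModuleCat.restrictScalars (algebraMap R S)).obj X)

lemma HasQuasiProjRes.restrictScalars (hf : Function.Surjective (algebraMap R S))
    (hker : ∀ r, algebraMap R S r = 0 ↔ x ∣ r) (hx : IsSMulRegular R x)
    {M : Type u} [AddCommGroup M] [Module R M] [Module S M] [IsScalarTower R S M]
    (h : HasQuasiProjRes S M) : HasQuasiProjRes R M := by
  obtain ⟨P, l, a, hP, ⟨s, hs⟩, ha, hne, hn⟩ := h
  have := hP.isKProjective
  have := hP.projective
  -- Cohomology can be nonzero only in degrees at most `-l`; truncating one step later makes `P`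
  -- exact at `m`, as projectivity of the cycles requires.
  obtain ⟨m, hm⟩ : ∃ m : ℤ, m = -l + 1 := ⟨_, rfl⟩
  have hLE : P.IsLE (m - 1) := by
    rw [CochainComplex.isLE_iff]
    intro i hi
    rw [exactAt_iff_isZero_homology]
    obtain ⟨i, rfl⟩ : ∃ j, i = -j := ⟨-i, by lia⟩
    obtain ⟨e⟩ := hn i
    have : IsEmpty (Fin (a i)) := by
      rw [ha i (by lia)]
      infer_instance
    have := e.injective.subsingleton
    exact ModuleCat.isZero_of_subsingleton _
  have hGE : P.IsStrictlyGE (-s) := by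
    rw [CochainComplex.isStrictlyGE_iff]
    intro i hi
    obtain ⟨i, rfl⟩ : ∃ j, i = -j := ⟨-i, by lia⟩
    have := hs i (by lia)
    exact ModuleCat.isZero_of_subsingleton _
  have hLE' : P.IsLE m := P.isLE_of_le (m - 1) m (by lia)
  let T := P.truncLE m
  have hTp (n : ℤ) : Projective (T.X n) := projective_truncLE P m n
  let G := ModuleCat.restrictScalars.{u} (algebraMap R S)
  let C := (G.mapHomologicalComplex (ComplexShape.up ℤ)).obj T
  have hcov (j : ℤ) :
      ∃ (F : ModuleCat.{u} R) (π : F →ₗ[R] C.X j), Function.Surjective π ∧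
      Module.Projective R F ∧ Module.Projective R (LinearMap.ker π) ∧
      (Subsingleton (C.X j) → Subsingleton F) :=
    exists_projective_cover_restrictScalars hf hker hx (T.X j)
  choose F π hπ hF hK hF0 using hcov
  obtain ⟨Q, φ, hφ, hQ⟩ := exists_resolution C F π hπ hF
  have hQ0 (j : ℤ) (h1 : Subsingleton (T.X j)) (h2 : Subsingleton (T.X (j + 1))) :
      Subsingleton (Q.X j) := by
    have := hF0 j h1
    have := hF0 (j + 1) h2
    obtain ⟨e⟩ := hQ j
    exact e.injective.subsingleton
  have hQp (j : ℤ) : Projective (Q.X j) := by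
    have := hF j
    have := hK (j + 1)
    obtain ⟨e⟩ := hQ j
    have : Module.Projective R (Q.X j) := Module.Projective.of_equiv e.symm
    exact (IsProjective.iff_projective (R := R) (Q.X j)).1 this
  have hQs : Q.IsStrictlyLE m := by
    rw [CochainComplex.isStrictlyLE_iff]
    intro i hi
    have := hQ0 i (ModuleCat.subsingleton_of_isZero (T.isZero_of_isStrictlyLE m i))
      (ModuleCat.subsingleton_of_isZero (T.isZero_of_isStrictlyLE m (i + 1)))
    exact ModuleCat.isZero_of_subsingleton _
  have := Q.isKProjective_of_projective m
  -- The bound grows to `s + 1` because `Q` in homological degree `i` involves the covers in degrees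
  -- `i` and `i - 1`.
  refine ⟨Q, l, a, isSemiProjective_of_isKProjective Q, ⟨s + 1, fun i hi => hQ0 (-i) ?_ ?_⟩,
    ha, hne, fun n => ?_⟩
  · exact ModuleCat.subsingleton_of_isZero (T.isZero_of_isStrictlyGE (-s) (-i))
  · exact ModuleCat.subsingleton_of_isZero (T.isZero_of_isStrictlyGE (-s) (-i + 1))
  · obtain ⟨e⟩ := hn n
    let e1 := (asIso (homologyMap φ (-n))).toLinearEquiv
    let e2 := (mapHomologyIso' G T (-n)).toLinearEquiv
    let e3 := (G.mapIso (asIso (homologyMap (P.ιTruncLE m) (-n)))).toLinearEquiv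
    refine ⟨e1 ≪≫ₗ e2 ≪≫ₗ e3 ≪≫ₗ { e.toAddEquiv with map_smul' := fun r y => ?_ }⟩
    refine (e.map_smul (algebraMap R S r) y).trans ?_
    exact algebraMap_smul S r _

end
-- From vanishing `Ext¹` to splitting, and induction on the sequence
open Abelian in
-- Decomposing both identities into coordinates writes a class in `Ext¹(M^b, M^a)` as a sum of terms
-- factoring through `Ext¹(M, M) = 0`. So the identity of `M^b` lifts to the middle term.
lemma selfExtensionsSplit_of_subsingleton_ext (R : Type u) [Ring R] (M : Type u) [AddCommGroup M]
    [Module R M] (h : Subsingleton (Ext (ModuleCat.of R M) (ModuleCat.of R M) 1)) :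
    SelfExtensionsSplit R M := by
  intro a b E _ _ i p hi hip hp
  have hS : (ShortComplex.moduleCatMk i p hip.linearMap_comp_eq_zero).ShortExact :=
    ModuleCat.shortComplex_shortExact _ hip hi hp
  have hsum (n : ℕ) : 𝟙 (ModuleCat.of R (Fin n → M)) = ∑ j : Fin n,
      ModuleCat.ofHom (LinearMap.proj j) ≫ ModuleCat.ofHom (LinearMap.single R (fun _ => M) j) := by
    ext v k
    simp [ModuleCat.hom_sum, Finset.sum_apply, Pi.single_apply]
  have hzero (e : Ext (ModuleCat.of R (Fin b → M)) (ModuleCat.of R (Fin a → M)) 1) : e = 0 := by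
    rw [← e.mk₀_id_comp, ← e.comp_mk₀_id, hsum a, hsum b, Ext.mk₀_sum, Ext.mk₀_sum, Ext.comp_sum,
      Ext.comp_sum]
    refine Finset.sum_eq_zero fun j _ => ?_
    rw [Ext.sum_comp]
    refine Finset.sum_eq_zero fun k _ => ?_
    have h0 : ((Ext.mk₀ (ModuleCat.ofHom (LinearMap.single R (fun _ : Fin b => M) k))).comp e
      (zero_add 1)).comp (Ext.mk₀ (ModuleCat.ofHom (LinearMap.proj j))) (add_zero 1) = 0 :=
      h.elim _ _
    rw [← Ext.mk₀_comp_mk₀, ← Ext.mk₀_comp_mk₀, Ext.comp_assoc_of_second_deg_zero,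
      ← Ext.comp_assoc_of_third_deg_zero, ← Ext.comp_assoc_of_third_deg_zero,
      ← Ext.comp_assoc_of_third_deg_zero, Ext.comp_assoc_of_third_deg_zero (Ext.mk₀ _), h0]
    simp
  obtain ⟨s, hs⟩ := Ext.covariant_sequence_exact₃ _ hS (Ext.mk₀ (𝟙 _)) (zero_add 1) (hzero _)
  obtain ⟨s, rfl⟩ := Ext.homEquiv₀.symm.surjective s
  rw [Ext.homEquiv₀_symm_apply, Ext.mk₀_comp_mk₀] at hs
  exact ⟨s.hom, congrArg ModuleCat.Hom.hom ((Ext.mk₀_bijective _ _).injective hs)⟩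

open scoped Pointwise in
lemma isWeaklyRegular_quotient_of_cons {R : Type u} [CommRing R] {x : R} {xs : List R}
    (h : RingTheory.Sequence.IsWeaklyRegular R (x :: xs)) :
    RingTheory.Sequence.IsWeaklyRegular (R ⧸ Ideal.span {x})
      (xs.map (Ideal.Quotient.mk (Ideal.span {x}))) := by
  have h1 := ((RingTheory.Sequence.isWeaklyRegular_cons_iff' R x xs).1 h).2
  have he : x • (⊤ : Submodule R R) = Ideal.span {x} := by
    rw [← Submodule.ideal_span_singleton_smul, smul_eq_mul, Ideal.mul_top]
  let e : QuotSMulTop x R ≃ₗ[R] R ⧸ Ideal.span {x} := Submodule.quotEquivOfEq _ _ he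
  exact ((e.extendScalarsOfSurjective Ideal.Quotient.mk_surjective).isWeaklyRegular_congr _).1 h1

/-- Allowing any `S` with surjective structure map and kernel `(xs)` avoids identifying iterated
quotients: the same `S` serves over `R` and over `R/(x)`. -/
lemma hasQuasiProjRes_iff_of_isWeaklyRegular {n : ℕ} : ∀ {R S : Type u} [CommRing R]
    [CommRing S] [Algebra R S] (xs : List R), xs.length = n →
    RingTheory.Sequence.IsWeaklyRegular R xs → Function.Surjective (algebraMap R S) →
    (∀ r, algebraMap R S r = 0 ↔ r ∈ Ideal.ofList xs) → ∀ (M : Type u) [AddCommGroup M]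
    [Module R M] [Module S M] [IsScalarTower R S M], SelfExtensionsSplit R M →
    (HasQuasiProjRes R M ↔ HasQuasiProjRes S M) := by
  induction n with
  | zero =>
    intro R S _ _ _ xs hn _ hf hker M _ _ _ _ _
    obtain rfl := List.length_eq_zero_iff.1 hn
    let e : R ≃+* S := RingEquiv.ofBijective (algebraMap R S)
      ⟨(injective_iff_map_eq_zero _).2 fun r hr => by simpa using (hker r).1 hr, hf⟩
    have he (r : R) (m : M) : e r • m = r • m := algebraMap_smul S r m
    refine ⟨.of_ringEquiv e.symm fun s m => ?_, .of_ringEquiv e he⟩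
    rw [← he, RingEquiv.apply_symm_apply]
  | succ n ih =>
    intro R S _ _ _ xs hn hxs hf hker M _ _ _ _ hM
    obtain ⟨x, xs, rfl⟩ := List.exists_cons_of_length_eq_add_one hn
    let T := R ⧸ Ideal.span {x}
    let _ : Algebra T S := (Ideal.Quotient.lift (Ideal.span {x}) (algebraMap R S) fun r hr =>
      (hker r).2 (by rw [Ideal.ofList_cons]; exact Ideal.mem_sup_left hr)).toAlgebra
    have hTS (r : R) : algebraMap T S (Ideal.Quotient.mk _ r) = algebraMap R S r := rfl
    let _ : Module T M := Module.compHom M (algebraMap T S)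
    have : IsScalarTower T S M := IsScalarTower.of_algebraMap_smul fun _ _ => rfl
    have : IsScalarTower R T M := IsScalarTower.of_algebraMap_smul fun r m =>
      algebraMap_smul S r m
    have hsurj : Function.Surjective (algebraMap R T) := Ideal.Quotient.mk_surjective
    have hx : ∀ r, algebraMap R T r = 0 ↔ x ∣ r := fun r =>
      Ideal.Quotient.eq_zero_iff_mem.trans Ideal.mem_span_singleton
    have hreg := ((RingTheory.Sequence.isWeaklyRegular_cons_iff' R x xs).1 hxs).1
    have hstep : HasQuasiProjRes R M ↔ HasQuasiProjRes T M :=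
      ⟨.of_surjective hsurj hx hreg hM, .restrictScalars hsurj hx hreg⟩
    refine hstep.trans (ih (xs.map (Ideal.Quotient.mk (Ideal.span {x}))) (by simpa using hn)
      (isWeaklyRegular_quotient_of_cons hxs) (fun s => ?_) (fun t => ?_) M
      (hM.of_surjective hsurj))
    · obtain ⟨r, rfl⟩ := hf s
      exact ⟨Ideal.Quotient.mk _ r, rfl⟩
    · obtain ⟨r, rfl⟩ := Ideal.Quotient.mk_surjective t
      rw [hTS, hker, ← Ideal.map_ofList, Ideal.mem_quotient_iff_mem_sup, Ideal.ofList_cons,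
        sup_comm]

end QuasiProj

theorem mainTheorem5 (R : Type u) [CommRing R] [IsNoetherianRing R] [IsLocalRing R]
    (xs : List R) (hxs : RingTheory.Sequence.IsRegular R xs)
    (M : Type u) [AddCommGroup M] [Module R M] [Module (R ⧸ Ideal.ofList xs) M]
    [IsScalarTower R (R ⧸ Ideal.ofList xs) M]
    [Nontrivial M] [Module.Finite (R ⧸ Ideal.ofList xs) M]
    (hExt : Subsingleton
      (CategoryTheory.Abelian.Ext (ModuleCat.of R M) (ModuleCat.of R M) 1)) :
    QuasiProj.qpd R M < ⊤ ↔ QuasiProj.qpd (R ⧸ Ideal.ofList xs) M < ⊤ := by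
  rw [QuasiProj.qpd_lt_top_iff, QuasiProj.qpd_lt_top_iff]
  exact QuasiProj.hasQuasiProjRes_iff_of_isWeaklyRegular xs rfl hxs.toIsWeaklyRegular
    Ideal.Quotient.mk_surjective (fun _ => Ideal.Quotient.eq_zero_iff_mem) M
    (QuasiProj.selfExtensionsSplit_of_subsingleton_ext R M hExt)
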